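/- **Setting.** Let $(\mathsf X,\mathcal X)$ be a measurable space, $T\ge 1$, and let $dx_{1:t}$ denote the product on $\mathsf X^t$ of fixed $\sigma$-finite dominating measures $dx_1,\dots,dx_t$ on $\mathsf X$. Let $\Theta$ be a parameter set. For $\theta\in\Theta$ and $1\le t\le T$ let $\gamma_{\theta,t}:\mathsf X^t\to[0,\infty)$ be measurable unnormalized densities with $0<Z_{\theta,t}=\int\gamma_{\theta,t}(x_{1:t})\,dx_{1:t}<\infty$, and put $\bar\gamma_{\theta,t}=\gamma_{\theta,t}/Z_{\theta,t}$; we write $\bar\gamma_{\theta,t}$ also for the probability distribution with this density. Let $r_{\theta,1}(x_1)$ and $r_{\theta,t}(x_t\mid x_{1:t-1})$, $2\le t\le T$, be jointly measurable proposal densities with respect to $dx_t$, each integrating to one in $x_t$ for every history $x_{1:t-1}$. The weight functions are $$W_{\theta,1}(x_1)=\frac{\gamma_{\theta,1}(x_1)}{r_{\theta,1}(x_1)},\qquad W_{\theta,t}(x_{1:t})=\frac{\gamma_{\theta,t}(x_{1:t})}{\gamma_{\theta,t-1}(x_{1:t-1})\,r_{\theta,t}(x_t\mid x_{1:t-1})}\quad(t\ge2),$$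 with $0/0=0$. Assume that the proposals cover the targets: for all $1\le t\le T$ and $x_{1:t}\in\mathsf X^t$, if $\gamma_{\theta,t}(x_{1:t})>0$ then $r_{\theta,t}(x_t\mid x_{1:t-1})\,\gamma_{\theta,t-1}(x_{1:t-1})>0$ (for $t=1$: then $r_{\theta,1}(x_1)>0$). **The PGAS kernel.** For $N\ge1$ and a reference trajectory $x'_{1:T}\in\mathsf X^T$, run the following algorithm. 1. Draw $x_1^i\sim r_{\theta,1}$ independently for $i=1,\dots,N-1$; set $x_1^N=x_1'$ and $w_1^i=W_{\theta,1}(x_1^i)$ for $i=1,\dots,N$. 2. For $t=2,\dots,T$, given the paths $x_{1:t-1}^i$ and weights $w_{t-1}^i$, independently: - for $i=1,\dots,N-1$, draw $(a_t^i,x_t^i)$ from $M_{\theta,t}(a,x)=\dfrac{w_{t-1}^{a}}{\sum_l w_{t-1}^l}\,r_{\theta,t}(x\mid x_{1:t-1}^{a})$; - set $x_t^N=x_t'$ and draw $a_t^N$ with $\mathbb P(a_t^N=i)\propto w_{t-1}^i\,\dfrac{\gamma_{\theta,T}((x_{1:t-1}^i,x'_{t:T}))}{\gamma_{\theta,t-1}(x_{1:t-1}^i)}$.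 Then set $x_{1:t}^i=(x_{1:t-1}^{a_t^i},x_t^i)$ and $w_t^i=W_{\theta,t}(x_{1:t}^i)$ for $i=1,\dots,N$. 3. Draw $k$ with $\mathbb P(k=i)\propto w_T^i$ and return $x_{1:T}^\star=x_{1:T}^k$. (Whenever an index is to be drawn and all its weights vanish, it is drawn uniformly from $\{1,\dots,N\}$.) Let $P_\theta^N(x'_{1:T},B)=\mathbb P(x^\star_{1:T}\in B)$. **Theorem.** For every $N\ge1$ and every $\theta\in\Theta$ such that the above assumption holds for $\theta$, $P_\theta^N$ is a Markov kernel on $\mathsf X^T$ and leaves $\bar\gamma_{\theta,T}$ invariant: $$\bar\gamma_{\theta,T}(B)=\int P_\theta^N(x'_{1:T},B)\,\bar\gamma_{\theta,T}(dx'_{1:T})\qquad\text{for all measurable }B\subseteq\mathsf X^T.$$ -/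

import Mathlib

open MeasureTheory ProbabilityTheory
open scoped ENNReal NNReal

namespace PGAS

/-- A (partial) trajectory `x_{1:t}`, a point of `X ^ t`. The entry with index `s : Fin t` is
`x_{s+1}`. -/
abbrev Traj (X : Type*) (t : ℕ) : Type _ := Fin t → X

/-- The dominating measure `dx_{1:t}` on `X ^ t`: the product of the dominating measures of the
coordinates, `μ s` being the one for `x_{s+1}`. -/
noncomputable def trajMeasure {X : Type*} [MeasurableSpace X] (μ : ℕ → Measure X) (t : ℕ) :
    Measure (Traj X t) :=
  Measure.pi fun s : Fin t => μ s

/-- The data of a sequential Monte Carlo sampler with time horizon `T` (for one parameter value):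
a sequence of unnormalized target densities and of proposal densities, all with respect to the
dominating measures `μ`. -/
structure Model {X : Type*} [MeasurableSpace X] (μ : ℕ → Measure X) (T : ℕ) where
  /-- The unnormalized target density `γ_t(x_{1:t})`; only `1 ≤ t ≤ T` matters. -/
  γ : (t : ℕ) → Traj X t → ℝ≥0
  /-- The proposal density: `r t h y` is the density at `y` of `x_{t+1}` given `x_{1:t} = h`; only
  `0 ≤ t < T` matters. For `t = 0` the history is empty and this is the initial proposal. -/
  r : (t : ℕ) → Traj X t → X → ℝ≥0
  measurable_γ : ∀ t, 1 ≤ t → t ≤ T → Measurable (γ t)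
  /-- The normalizing constants are positive ... -/
  normConst_pos : ∀ t, 1 ≤ t → t ≤ T → 0 < ∫⁻ x, γ t x ∂(trajMeasure μ t)
  /-- ... and finite. -/
  normConst_lt_top : ∀ t, 1 ≤ t → t ≤ T → ∫⁻ x, γ t x ∂(trajMeasure μ t) < ∞
  measurable_r : ∀ t, t < T → Measurable (Function.uncurry (r t))
  lintegral_r : ∀ t, t < T → ∀ h : Traj X t, ∫⁻ y, r t h y ∂(μ t) = 1

/-- The categorical distribution on particle indices, `ℙ(k = i) ∝ w i`, as a Markov kernel in the
vector of weights `w`. If all weights vanish the index is drawn uniformly. -/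
noncomputable def categorical (N : ℕ) : Kernel (Fin N → ℝ≥0) (Fin N) where
  toFun w := ∑ i, (if ∑ l, w l = 0 then (N : ℝ≥0∞)⁻¹ else ((w i / ∑ l, w l : ℝ≥0) : ℝ≥0∞)) •
    Measure.dirac i
  measurable' := by
    refine Measure.measurable_of_measurable_coe _ fun s _ => ?_
    simp only [Measure.coe_finsetSum, Finset.sum_apply, Measure.smul_apply, smul_eq_mul]
    refine Finset.measurable_sum _ fun i _ => Measurable.mul_const ?_ _
    refine Measurable.ite (measurableSet_eq_fun (by fun_prop) (by fun_prop)) (by fun_prop)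
      (by fun_prop)

instance (N : ℕ) [NeZero N] : IsMarkovKernel (categorical N) where
  isProbabilityMeasure w := by
    constructor
    change (∑ i, (if ∑ l, w l = 0 then (N : ℝ≥0∞)⁻¹ else ((w i / ∑ l, w l : ℝ≥0) : ℝ≥0∞)) •
      Measure.dirac i : Measure (Fin N)) Set.univ = 1
    simp only [Measure.coe_finsetSum, Finset.sum_apply, Measure.smul_apply, smul_eq_mul,
      measure_univ, mul_one]
    split_ifs with h
    · simp [ENNReal.mul_inv_cancel (by simpa using NeZero.ne N) (ENNReal.natCast_ne_top N)]
    · rw [← ENNReal.ofNNReal_finsetSum, ← Finset.sum_div, div_self h, ENNReal.coe_one]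

/-- Independent draws: the product of finitely many Markov kernels from a common source,
`a ↦ ⨂ i, κ i a`. -/
noncomputable def indep {α β ι : Type*} [MeasurableSpace α] [MeasurableSpace β] [Fintype ι]
    (κ : ι → Kernel α β) [∀ i, IsMarkovKernel (κ i)] : Kernel α (ι → β) where
  toFun a := Measure.pi fun i => κ i a
  measurable' := by
    refine Measurable.measure_of_isPiSystem_of_isProbabilityMeasure generateFrom_pi.symm
      isPiSystem_pi ?_
    rintro _ ⟨s, hs, rfl⟩
    simp only [Measure.pi_pi]
    exact Finset.measurable_prod _ fun i _ => (κ i).measurable_coe (hs i (Set.mem_univ i))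

instance {α β ι : Type*} [MeasurableSpace α] [MeasurableSpace β] [Fintype ι]
    (κ : ι → Kernel α β) [∀ i, IsMarkovKernel (κ i)] : IsMarkovKernel (indep κ) where
  isProbabilityMeasure a := inferInstanceAs (IsProbabilityMeasure (Measure.pi fun i => κ i a))

/-- The concatenation `(x_{1:t}, x'_{t+1:T})`. -/
def concat {X : Type*} {t T : ℕ} (x : Traj X t) (x' : Traj X T) : Traj X T :=
  fun s => if h : (s : ℕ) < t then x ⟨s, h⟩ else x' s

/-- The index of the `N`-th particle, the one that carries the reference trajectory. -/
def refIndex (N : ℕ) [NeZero N] : Fin N := ⟨N - 1, Nat.sub_lt (NeZero.pos N) Nat.one_pos⟩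

namespace Model

variable {X : Type*} [MeasurableSpace X] {μ : ℕ → Measure X} {T : ℕ} (M : Model μ T)

/-- The normalizing constant `Z_t = ∫ γ_t(x_{1:t}) dx_{1:t}`. -/
noncomputable def normConst (t : ℕ) : ℝ≥0∞ := ∫⁻ x, M.γ t x ∂(trajMeasure μ t)

/-- The target distribution at time `t`, with density `γ_t(x_{1:t}) / Z_t`. -/
noncomputable def target (t : ℕ) : Measure (Traj X t) :=
  (trajMeasure μ t).withDensity fun x => M.γ t x / M.normConst t

/-- The support of the proposal covers that of the target: for `1 ≤ t ≤ T`, if `γ_t(x_{1:t}) > 0`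
then `γ_{t-1}(x_{1:t-1}) r_t(x_t | x_{1:t-1}) > 0`, where the factor `γ_{t-1}` is absent if
`t = 1`. -/
def SupportCondition : Prop :=
  ∀ t, t < T → ∀ x : Traj X (t + 1), 0 < M.γ (t + 1) x →
    0 < M.r t (Fin.init x) (x (Fin.last t)) ∧ (1 ≤ t → 0 < M.γ t (Fin.init x))

/-- The weight function `W_t`: `γ_1(x_1) / r_1(x_1)` for `t = 1`, and
`γ_t(x_{1:t}) / (γ_{t-1}(x_{1:t-1}) r_t(x_t | x_{1:t-1}))` for `t ≥ 2` (`t = 0` is not used). -/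
noncomputable def weight : (t : ℕ) → Traj X t → ℝ≥0
  | 0, _ => 1
  | 1, x => M.γ 1 x / M.r 0 (Fin.init x) (x 0)
  | t + 2, x => M.γ (t + 2) x /
      (M.γ (t + 1) (Fin.init x) * M.r (t + 1) (Fin.init x) (x (Fin.last (t + 1))))

/-- The ancestor sampling weight of a particle path `x_{1:t}`, for the reference trajectory `x'`:
`W_t(x_{1:t}) γ_T((x_{1:t}, x'_{t+1:T})) / γ_t(x_{1:t})`. -/
noncomputable def ancestorWeight (t : ℕ) (x' : Traj X T) (x : Traj X t) : ℝ≥0 :=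
  M.weight t x * (M.γ T (concat x x') / M.γ t x)

theorem measurable_init (t : ℕ) :
    Measurable (fun x : Traj X (t + 1) => (Fin.init x : Traj X t)) :=
  measurable_pi_lambda _ fun _ => measurable_pi_apply _

theorem measurable_concat {t : ℕ} :
    Measurable (fun z : Traj X T × Traj X t => concat z.2 z.1) := by
  refine measurable_pi_lambda _ fun s => ?_
  unfold concat
  split_ifs <;> fun_prop

theorem measurable_weight : ∀ t, t ≤ T → Measurable (M.weight t)
  | 0, _ => measurable_const
  | 1, h => (M.measurable_γ 1 le_rfl h).div
      ((M.measurable_r 0 h).comp ((measurable_init 0).prodMk (measurable_pi_apply _)))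
  | t + 2, h => (M.measurable_γ (t + 2) (by omega) h).div
      (((M.measurable_γ (t + 1) (by omega) (by omega)).comp (measurable_init _)).mul
        ((M.measurable_r (t + 1) h).comp ((measurable_init _).prodMk (measurable_pi_apply _))))

theorem measurable_ancestorWeight (t : ℕ) (h1 : 1 ≤ t) (ht : t ≤ T) :
    Measurable (fun z : Traj X T × Traj X t => M.ancestorWeight t z.1 z.2) :=
  ((M.measurable_weight t ht).comp measurable_snd).mul
    (((M.measurable_γ T (h1.trans ht) le_rfl).comp measurable_concat).div
      ((M.measurable_γ t h1 ht).comp measurable_snd))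

section Algorithm

/-- The initial proposal: the law of `x_1 ~ r_1`. -/
noncomputable def initDraw : Kernel (Traj X T) X :=
  Kernel.const _ ((μ 0).withDensity fun y => M.r 0 Fin.elim0 y)

theorem isMarkovKernel_initDraw (hT : 0 < T) : IsMarkovKernel M.initDraw := by
  refine ⟨fun a => ⟨?_⟩⟩
  simpa [initDraw] using M.lintegral_r 0 hT Fin.elim0

variable [∀ t, SigmaFinite (μ t)] (N : ℕ) [NeZero N]

/-- The proposal `M_{t+1}(a, y) = (w_t^a / ∑_l w_t^l) r_{t+1}(y | x_{1:t}^a)` for an ordinary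
particle and its ancestor index, as a density with respect to the product of counting measure (via
the categorical distribution of `a`) and `μ t`. It depends on the particle paths `z.2` at time `t`;
`z.1` is the reference trajectory. -/
noncomputable def proposalDraw (t : ℕ) (ht : t ≤ T) :
    Kernel (Traj X T × (Fin N → Traj X t)) (Fin N × X) :=
  Kernel.withDensity
    (((categorical N).comap
        (fun (z : Traj X T × (Fin N → Traj X t)) l => M.weight t (z.2 l))
        (measurable_pi_lambda _ fun l => (M.measurable_weight t ht).comp
          ((measurable_pi_apply l).comp measurable_snd))) ×ₖ
      Kernel.const _ (μ t))
    fun z ay => M.r t (z.2 ay.1) ay.2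

/-- The draw for the `N`-th particle: the ancestor index is sampled with probabilities proportional
to the ancestor sampling weights, and `x_{t+1}` is set to `x'_{t+1}`. -/
noncomputable def referenceDraw (t : ℕ) (h1 : 1 ≤ t) (ht : t < T) :
    Kernel (Traj X T × (Fin N → Traj X t)) (Fin N × X) :=
  ((categorical N).comap
      (fun (z : Traj X T × (Fin N → Traj X t)) l => M.ancestorWeight t z.1 (z.2 l))
      (measurable_pi_lambda _ fun l => (M.measurable_ancestorWeight t h1 ht.le).comp
        (measurable_fst.prodMk ((measurable_pi_apply l).comp measurable_snd)))) ×ₖ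
    Kernel.deterministic (fun z : Traj X T × (Fin N → Traj X t) => z.1 ⟨t, ht⟩) (by fun_prop)

instance (t : ℕ) (h1 : 1 ≤ t) (ht : t < T) : IsMarkovKernel (M.referenceDraw N t h1 ht) := by
  unfold referenceDraw; infer_instance

theorem isMarkovKernel_proposalDraw (t : ℕ) (ht : t < T) :
    IsMarkovKernel (M.proposalDraw N t ht.le) := by
  have hm : Measurable (Function.uncurry fun (z : Traj X T × (Fin N → Traj X t))
      (ay : Fin N × X) => (M.r t (z.2 ay.1) ay.2 : ℝ≥0∞)) := by
    refine ((M.measurable_r t ht).comp (Measurable.prodMk ?_ (by fun_prop))).coe_nnreal_ennreal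
    exact (measurable_from_prod_countable_left
      (f := fun q : (Fin N → Traj X t) × Fin N => q.1 q.2) fun i => measurable_pi_apply i).comp
        ((measurable_snd.comp measurable_fst).prodMk (measurable_fst.comp measurable_snd))
  refine ⟨fun z => ⟨?_⟩⟩
  unfold proposalDraw
  rw [Kernel.withDensity_apply _ hm, withDensity_apply _ MeasurableSet.univ, setLIntegral_univ,
    Kernel.prod_apply, Kernel.const_apply, lintegral_prod _ (by
      exact (hm.comp (measurable_const.prodMk measurable_id)).aemeasurable)]
  simp [M.lintegral_r t ht]

/-- The particles at time `1`: independent draws from `r_1`, except that the `N`-th particle is the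
reference `x'_1`. -/
noncomputable def initStep (hT : 0 < T) : Kernel (Traj X T) (Fin N → Traj X 1) :=
  haveI := M.isMarkovKernel_initDraw hT
  haveI : ∀ i, IsMarkovKernel (if i = refIndex N then
      Kernel.deterministic (fun x' : Traj X T => x' ⟨0, hT⟩) (measurable_pi_apply _) else M.initDraw) :=
    fun i => by split_ifs <;> infer_instance
  (indep fun i : Fin N => if i = refIndex N then
      Kernel.deterministic (fun x' : Traj X T => x' ⟨0, hT⟩) (measurable_pi_apply _) else M.initDraw).map
    fun x i _ => x i

/-- One time step, from the particle paths `x_{1:t}^i` (`z.2`; `z.1` is the reference trajectory)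
to the particle paths at time `t + 1`: draw all pairs `(a^i, x_{t+1}^i)` independently, by the
proposal for the first `N - 1` particles and by ancestor sampling for the `N`-th one, and set
`x_{1:t+1}^i = (x_{1:t}^{a^i}, x_{t+1}^i)`. -/
noncomputable def step (t : ℕ) (h1 : 1 ≤ t) (ht : t < T) :
    Kernel (Traj X T × (Fin N → Traj X t)) (Fin N → Traj X (t + 1)) :=
  haveI := M.isMarkovKernel_proposalDraw N t ht
  haveI : ∀ i, IsMarkovKernel (if i = refIndex N then M.referenceDraw N t h1 ht
      else M.proposalDraw N t ht.le) :=
    fun i => by split_ifs <;> infer_instance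
  (Kernel.id ×ₖ indep fun i : Fin N => if i = refIndex N then M.referenceDraw N t h1 ht
      else M.proposalDraw N t ht.le).map
    fun q i => (Fin.snoc (q.1.2 (q.2 i).1) (q.2 i).2 : Traj X (t + 1))

/-- The law of all particle paths `(x_{1:t}^i)_i` after `t` time steps of the algorithm, given the
reference trajectory. -/
noncomputable def paths : (t : ℕ) → t ≤ T → Kernel (Traj X T) (Fin N → Traj X t)
  | 0, _ => Kernel.deterministic (fun _ _ => Fin.elim0) measurable_const
  | 1, h => M.initStep N h
  | t + 2, h => M.step N (t + 1) (Nat.le_add_left 1 t) h ∘ₖ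
      (Kernel.id ×ₖ paths (t + 1) (Nat.le_of_succ_le h))

/-- The final draw: the path `x_{1:T}^k` with `ℙ(k = i) ∝ W_T(x_{1:T}^i)`. -/
noncomputable def select : Kernel (Fin N → Traj X T) (Traj X T) :=
  (((categorical N).comap (fun (p : Fin N → Traj X T) l => M.weight T (p l))
      (measurable_pi_lambda _ fun l => (M.measurable_weight T le_rfl).comp
        (measurable_pi_apply l))) ×ₖ
    Kernel.id).map fun kp => kp.2 kp.1

/-- The kernel of particle Gibbs with ancestor sampling, with `N` particles: the law of the
returned trajectory as a function of the reference trajectory. -/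
noncomputable def pgasKernel : Kernel (Traj X T) (Traj X T) :=
  M.select N ∘ₖ M.paths N T le_rfl

end Algorithm

end Model

end PGAS

/-!
Particle Gibbs with ancestor sampling is compared with plain sequential Monte Carlo, in which all
`N` particles, including the last one, evolve by the proposal. Let `η_t` be the law of the particle
paths of plain sequential Monte Carlo at time `t`, reweighted by the product of the average weights
at the earlier times (`Model.smcMeasure`). Two facts about `η_t` are used: given the past, the
particles are independent and identically distributed, so `η_t` is exchangeable
(`Model.lintegral_smcMeasure_perm`); and `∫ W_t(x_{1:t}^i) f(x_{1:t}^i) dη_t = ∫ γ_t f`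
(`SupportCondition.lintegral_weight_smcMeasure`).

The main point (`SupportCondition.lintegral_paths`) is that if the reference `x'` is drawn from the
unnormalized target `γ_T`, then the particle paths of the conditional algorithm at time `t` and the
part `u = x'_{t+1:T}` of the reference that is still to come have the joint density
`A_t(x_{1:t}^N, u) = W_t(x_{1:t}^N) γ_T(x_{1:t}^N, u) / γ_t(x_{1:t}^N)` with respect to
`η_t ⊗ dx_{t+1:T}`. This is proved by induction on `t`. The law of the next step is symmetric in
the current particles, so by exchangeability `A_t(x_{1:t}^N, u)` may be replaced by the average of
the `A_t(x_{1:t}^i, u)`. That average cancels the normalization of the ancestor sampling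
probabilities, and `W_t(q) r_{t+1}(y | q) A_{t+1}((q, y), u) = A_t(q, (y, u))` identifies the result
with a step of plain sequential Monte Carlo.

At time `T` the density is `W_T(x_{1:T}^N)`. The same symmetrization shows that the final draw of a
path, with probabilities proportional to the weights `W_T`, returns a path with the law of the
`N`-th one, and this law is the target by unbiasedness.
-/

namespace PGAS

/-! ### Product measures -/

section Product

variable {α ι : Type*} [MeasurableSpace α]

theorem measurable_update_prod [DecidableEq ι] (i : ι) :
    Measurable fun z : α × (ι → α) => Function.update z.2 i z.1 := by
  refine measurable_pi_lambda _ fun j => ?_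
  by_cases h : j = i
  · subst h; simpa using measurable_fst
  · simp only [Function.update_of_ne h]; fun_prop

variable [Fintype ι]

/-- Replacing the factor `i` of a product of probability measures by `ρ` amounts to overwriting
that coordinate by an independent draw from `ρ`. -/
theorem pi_update_eq_map [DecidableEq ι] (ν : Measure α) [IsProbabilityMeasure ν] (ρ : Measure α)
    [SigmaFinite ρ] (i : ι) :
    Measure.pi (Function.update (fun _ : ι => ν) i ρ) =
      (ρ.prod (Measure.pi fun _ : ι => ν)).map fun z => Function.update z.2 i z.1 := by
  have : ∀ j, SigmaFinite (Function.update (fun _ : ι => ν) i ρ j) := fun j => by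
    by_cases h : j = i
    · subst h; simpa
    · rw [Function.update_of_ne h]; infer_instance
  refine Measure.pi_eq fun s hs => ?_
  have hpre : (fun z : α × (ι → α) => Function.update z.2 i z.1) ⁻¹' Set.univ.pi s =
      s i ×ˢ Set.univ.pi (Function.update s i Set.univ) := by
    ext z
    simp only [Set.mem_preimage, Set.mem_univ_pi, Set.mem_prod]
    constructor
    · intro h
      refine ⟨by simpa using h i, fun j => ?_⟩
      by_cases hj : j = i
      · subst hj; simp
      · simpa [Function.update_of_ne hj] using h j
    · rintro ⟨h1, h2⟩ j
      by_cases hj : j = i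
      · subst hj; simpa
      · simpa [Function.update_of_ne hj] using h2 j
  rw [Measure.map_apply (measurable_update_prod i) (.univ_pi hs), hpre, Measure.prod_prod,
    Measure.pi_pi, ← Finset.mul_prod_erase _ _ (Finset.mem_univ i),
    ← Finset.mul_prod_erase _ (fun j => Function.update (fun _ : ι => ν) i ρ j (s j))
      (Finset.mem_univ i)]
  simp only [Function.update_self, measure_univ, one_mul]
  congr 1
  refine Finset.prod_congr rfl fun j hj => ?_
  rw [Function.update_of_ne (Finset.ne_of_mem_erase hj),
    Function.update_of_ne (Finset.ne_of_mem_erase hj)]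

theorem lintegral_pi_update [DecidableEq ι] (ν : Measure α) [IsProbabilityMeasure ν]
    (ρ : Measure α) [SigmaFinite ρ] (i : ι) {f : (ι → α) → ℝ≥0∞} (hf : Measurable f) :
    ∫⁻ q, f q ∂Measure.pi (Function.update (fun _ : ι => ν) i ρ) =
      ∫⁻ y, ∫⁻ q, f (Function.update q i y) ∂(Measure.pi fun _ : ι => ν) ∂ρ := by
  rw [pi_update_eq_map, lintegral_map hf (measurable_update_prod i),
    lintegral_prod (fun z : α × (ι → α) => f (Function.update z.2 i z.1))
      (hf.comp (measurable_update_prod i)).aemeasurable]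

/-- Independent and identically distributed draws are exchangeable. -/
theorem pi_map_perm (ν : Measure α) [IsProbabilityMeasure ν] (σ : Equiv.Perm ι) :
    (Measure.pi fun _ : ι => ν).map (fun q => q ∘ σ) = Measure.pi fun _ : ι => ν := by
  symm
  refine Measure.pi_eq fun s hs => ?_
  rw [Measure.map_apply (by fun_prop) (.univ_pi hs)]
  have hpre : (fun q : ι → α => q ∘ σ) ⁻¹' Set.univ.pi s = Set.univ.pi (s ∘ σ.symm) := by
    ext q
    simp only [Set.mem_preimage, Set.mem_univ_pi, Function.comp_apply]
    exact ⟨fun h i => by simpa using h (σ.symm i), fun h i => by simpa using h (σ i)⟩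
  rw [hpre, Measure.pi_pi]
  exact Equiv.prod_comp σ.symm fun i => ν (s i)

theorem lintegral_pi_eval (ν : Measure α) [IsProbabilityMeasure ν] (i : ι) {f : α → ℝ≥0∞}
    (hf : Measurable f) : ∫⁻ q, f (q i) ∂(Measure.pi fun _ : ι => ν) = ∫⁻ y, f y ∂ν :=
  (measurePreserving_eval (fun _ : ι => ν) i).lintegral_comp hf

/-- A weight on the coordinate `i` can be integrated last, with that coordinate held fixed in the
remaining factor. -/
theorem lintegral_pi_eval_mul [DecidableEq ι] (ν : Measure α)
    [IsProbabilityMeasure ν] (i : ι) {g : α → ℝ≥0∞} (hg : Measurable g)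
    {f : (ι → α) → ℝ≥0∞} (hf : Measurable f) :
    ∫⁻ q, g (q i) * f q ∂(Measure.pi fun _ : ι => ν) =
      ∫⁻ y, g y * ∫⁻ q, f (Function.update q i y) ∂(Measure.pi fun _ : ι => ν) ∂ν := by
  have h := lintegral_pi_update ν ν i (f := fun q => g (q i) * f q)
    ((hg.comp (measurable_pi_apply i)).mul hf)
  rw [Function.update_eq_self i (fun _ : ι => ν)] at h
  rw [h]
  refine lintegral_congr fun y => ?_
  simp only [Function.update_self]
  exact lintegral_const_mul _ (hf.comp ((measurable_update_prod i).comp measurable_prodMk_left))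

end Product

/-! ### Sampling an index -/

section Categorical

variable {N : ℕ} (w : Fin N → ℝ≥0) (f : Fin N → ℝ≥0∞)

theorem lintegral_categorical : ∫⁻ i, f i ∂categorical N w =
    ∑ i, (if ∑ l, w l = 0 then (N : ℝ≥0∞)⁻¹ else ((w i / ∑ l, w l : ℝ≥0) : ℝ≥0∞)) * f i := by
  change ∫⁻ i, f i ∂(∑ i, (if ∑ l, w l = 0 then (N : ℝ≥0∞)⁻¹
    else ((w i / ∑ l, w l : ℝ≥0) : ℝ≥0∞)) • Measure.dirac i : Measure (Fin N)) = _
  simp only [lintegral_finsetSum_measure, lintegral_smul_measure, lintegral_dirac, smul_eq_mul]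

/-- The total weight cancels the normalization of the index distribution. This also holds if all
weights vanish, when both sides are zero. -/
theorem sum_mul_lintegral_categorical :
    (∑ l, (w l : ℝ≥0∞)) * ∫⁻ i, f i ∂categorical N w = ∑ i, (w i : ℝ≥0∞) * f i := by
  rw [lintegral_categorical, ← ENNReal.ofNNReal_finsetSum]
  split_ifs with h
  · have h0 : ∀ i, w i = 0 := fun i => (Finset.sum_eq_zero_iff.1 h) i (Finset.mem_univ i)
    simp [h0]
  · rw [Finset.mul_sum]
    refine Finset.sum_congr rfl fun i _ => ?_
    rw [← mul_assoc, ← ENNReal.coe_mul, mul_div_cancel₀ _ h]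

theorem lintegral_categorical_perm (σ : Equiv.Perm (Fin N)) :
    ∫⁻ i, f (σ i) ∂categorical N (fun i => w (σ i)) = ∫⁻ i, f i ∂categorical N w := by
  rw [lintegral_categorical, lintegral_categorical, Equiv.sum_comp σ w]
  exact Equiv.sum_comp σ fun i => (if ∑ l, w l = 0 then (N : ℝ≥0∞)⁻¹
    else ((w i / ∑ l, w l : ℝ≥0) : ℝ≥0∞)) * f i

end Categorical

/-! ### Trajectories -/

section Trajectories

variable {X : Type*} {t T : ℕ}

/-- Appending `y` to a prefix gives the same trajectory as writing `y` into the reference, at the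
first position after the prefix. -/
theorem concat_snoc (q : Traj X t) (y : X) (x' : Traj X T) (ht : t < T) :
    concat (Fin.snoc q y : Traj X (t + 1)) x' = concat q (Function.update x' ⟨t, ht⟩ y) := by
  funext s
  unfold concat
  rcases lt_trichotomy (s : ℕ) t with h | h | h
  · simp [h, Nat.lt_succ_of_lt h, Fin.snoc]
  · obtain rfl : s = ⟨t, ht⟩ := Fin.ext h
    simp [Fin.snoc]
  · have h1 : ¬ (s : ℕ) < t + 1 := by omega
    have h2 : s ≠ ⟨t, ht⟩ := fun e => by simp [e] at h
    simp [h1, h.not_gt, h2]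

theorem concat_full (q x' : Traj X T) : concat q x' = q := by
  funext s; simp [concat]

theorem concat_congr (q : Traj X t) {x x' : Traj X T} (h : ∀ s : Fin T, t ≤ s → x s = x' s) :
    concat q x = concat q x' := by
  funext s
  unfold concat
  split_ifs with hs
  · rfl
  · exact h s (not_lt.1 hs)

variable [MeasurableSpace X]

theorem measurable_snoc :
    Measurable fun z : Traj X t × X => (Fin.snoc z.1 z.2 : Traj X (t + 1)) := by
  refine measurable_pi_lambda _ fun s => ?_
  refine Fin.lastCases ?_ (fun s => ?_) s
  · simpa using measurable_snd
  · simp only [Fin.snoc_castSucc]; fun_prop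

theorem lintegral_trajMeasure_succ (μ : ℕ → Measure X) [∀ t, SigmaFinite (μ t)]
    {f : Traj X (t + 1) → ℝ≥0∞} (hf : Measurable f) :
    ∫⁻ x, f x ∂trajMeasure μ (t + 1) =
      ∫⁻ q, ∫⁻ y, f (Fin.snoc q y) ∂μ t ∂trajMeasure μ t := by
  have h : trajMeasure μ (t + 1) = ((trajMeasure μ t).prod (μ t)).map
      fun z => (Fin.snoc z.1 z.2 : Traj X (t + 1)) := by
    refine Measure.pi_eq fun s hs => ?_
    have hpre : (fun z : Traj X t × X => (Fin.snoc z.1 z.2 : Traj X (t + 1))) ⁻¹' Set.univ.pi s =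
        (Set.univ.pi fun i : Fin t => s i.castSucc) ×ˢ s (Fin.last t) := by
      ext z
      simp [Fin.forall_fin_succ']
    rw [Measure.map_apply measurable_snoc (.univ_pi hs), hpre, Measure.prod_prod, trajMeasure,
      Measure.pi_pi, Fin.prod_univ_castSucc]
    simp
  have : SigmaFinite (trajMeasure μ t) := by unfold trajMeasure; infer_instance
  rw [h, lintegral_map hf measurable_snoc,
    lintegral_prod (fun z : Traj X t × X => f (Fin.snoc z.1 z.2))
      (hf.comp measurable_snoc).aemeasurable]

theorem lintegral_trajMeasure_one (μ : ℕ → Measure X) [∀ t, SigmaFinite (μ t)]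
    {f : Traj X 1 → ℝ≥0∞} (hf : Measurable f) :
    ∫⁻ x, f x ∂trajMeasure μ 1 = ∫⁻ y, f (fun _ => y) ∂μ 0 := by
  rw [lintegral_trajMeasure_succ μ hf, trajMeasure, Measure.pi_of_empty _ Fin.elim0,
    lintegral_dirac' _ Subsingleton.measurable]
  rcongr

theorem measurable_select (N T : ℕ) :
    Measurable fun kp : Fin N × (Fin N → Traj X T) => kp.2 kp.1 :=
  measurable_from_prod_countable_right
    (f := fun kp : Fin N × (Fin N → Traj X T) => kp.2 kp.1) fun i => measurable_pi_apply i

end Trajectories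

namespace Model

variable {X : Type*} [MeasurableSpace X] {μ : ℕ → Measure X} {T : ℕ} {M : Model μ T}

/-! ### Weights -/

section Weights

variable {t : ℕ}

/-- Positivity of the final target propagates backwards to all prefixes of a trajectory, by the
support condition at each time. -/
theorem SupportCondition.pos_of_pos (hM : M.SupportCondition) (h1 : 1 ≤ t) (ht : t ≤ T)
    {q : Traj X t} {x' : Traj X T} (h : 0 < M.γ T (concat q x')) : 0 < M.γ t q := by
  induction hn : T - t generalizing t with
  | zero =>
    obtain rfl : t = T := by omega
    rwa [concat_full] at h
  | succ n ih =>
    have ht' : t < T := by omega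
    have h' : 0 < M.γ (t + 1) (Fin.snoc q (x' ⟨t, ht'⟩)) := by
      refine ih (by omega) ht' ?_ (by omega)
      rwa [concat_snoc q _ x' ht', Function.update_eq_self]
    have := (hM t ht' _ h').2 h1
    rwa [Fin.init_snoc] at this

theorem SupportCondition.gamma_mul_weight (hM : M.SupportCondition) (h1 : 1 ≤ t) (ht : t < T)
    (q : Traj X t) (y : X) :
    M.γ t q * (M.r t q y * M.weight (t + 1) (Fin.snoc q y)) = M.γ (t + 1) (Fin.snoc q y) := by
  obtain ⟨s, rfl⟩ : ∃ s, t = s + 1 := ⟨t - 1, by omega⟩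
  rcases eq_or_ne (M.γ (s + 2) (Fin.snoc q y)) 0 with h | h
  · simp [weight, h]
  · obtain ⟨hr, hγ⟩ := hM (s + 1) ht _ (pos_iff_ne_zero.2 h)
    simp only [Fin.init_snoc, Fin.snoc_last] at hr hγ
    have := hr.ne'
    have := (hγ h1).ne'
    simp only [weight, Fin.init_snoc, Fin.snoc_last]
    field_simp

theorem SupportCondition.proposal_mul_weight_one (hM : M.SupportCondition) (hT : 0 < T) (y : X) :
    M.r 0 Fin.elim0 y * M.weight 1 (fun _ => y) = M.γ 1 (fun _ => y) := by
  rcases eq_or_ne (M.γ 1 (fun _ => y)) 0 with h | h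
  · simp [weight, h]
  · have hr := (hM 0 hT _ (pos_iff_ne_zero.2 h)).1.ne'
    rw [Subsingleton.elim (Fin.init fun _ => y) Fin.elim0] at hr
    simp only [weight]
    rw [Subsingleton.elim (Fin.init fun _ => y) Fin.elim0, mul_div_cancel₀ _ hr]

/-- Extending a path by the coordinate `y` of the reference: the ancestor weight of the extended
path times the density of the extension is the ancestor weight of the shorter path. -/
theorem SupportCondition.weight_mul_ancestorWeight (hM : M.SupportCondition) (h1 : 1 ≤ t)
    (ht : t < T) (x' : Traj X T) (q : Traj X t) (y : X) :
    M.weight t q * (M.r t q y * M.ancestorWeight (t + 1) x' (Fin.snoc q y)) =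
      M.ancestorWeight t (Function.update x' ⟨t, ht⟩ y) q := by
  unfold ancestorWeight
  rw [← concat_snoc q y x' ht]
  rcases eq_or_ne (M.γ T (concat (Fin.snoc q y : Traj X (t + 1)) x')) 0 with h | h
  · simp [h]
  · have hp := (hM.pos_of_pos (Nat.le_add_left 1 t) ht (pos_iff_ne_zero.2 h)).ne'
    have hq : M.γ t q ≠ 0 := fun h0 => hp (by rw [← hM.gamma_mul_weight h1 ht, h0, zero_mul])
    rw [← hM.gamma_mul_weight h1 ht] at hp ⊢
    have h2 := right_ne_zero_of_mul hp
    have := left_ne_zero_of_mul h2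
    have := right_ne_zero_of_mul h2
    field_simp

theorem SupportCondition.proposal_mul_ancestorWeight_one (hM : M.SupportCondition) (hT : 0 < T)
    (x' : Traj X T) (y : X) :
    M.r 0 Fin.elim0 y * M.ancestorWeight 1 x' (fun _ => y) =
      M.γ T (Function.update x' ⟨0, hT⟩ y) := by
  have hc : concat (fun _ => y : Traj X 1) x' = Function.update x' ⟨0, hT⟩ y := by
    funext s
    rcases Nat.eq_zero_or_pos (s : ℕ) with h | h
    · obtain rfl : s = ⟨0, hT⟩ := Fin.ext h
      simp [concat]
    · have h2 : s ≠ ⟨0, hT⟩ := fun e => by simp [e] at h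
      simp [concat, h2, h.ne']
  unfold ancestorWeight
  rw [← mul_assoc, hM.proposal_mul_weight_one hT, hc]
  rcases eq_or_ne (M.γ T (Function.update x' ⟨0, hT⟩ y)) 0 with h | h
  · simp [h]
  · rw [← hc] at h
    rw [mul_div_cancel₀ _ (hM.pos_of_pos le_rfl hT (pos_iff_ne_zero.2 h)).ne']

/-- At the final time the ratio `γ_T / γ_T` drops out, also at zeros of `γ_T`, where the weight
itself vanishes. -/
theorem ancestorWeight_full (hT : 0 < T) (x' q : Traj X T) :
    M.ancestorWeight T x' q = M.weight T q := by
  rw [ancestorWeight, concat_full]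
  rcases eq_or_ne (M.γ T q) 0 with h | h
  · have : M.weight T q = 0 := by
      match T, hT, M, q, h with
      | 1, _, M, q, h => simp [weight, h]
      | t + 2, _, M, q, h => simp [weight, h]
    simp [this]
  · rw [div_self h, mul_one]

theorem ancestorWeight_congr {x x' : Traj X T} (h : ∀ s : Fin T, t ≤ s → x s = x' s)
    (q : Traj X t) : M.ancestorWeight t x q = M.ancestorWeight t x' q := by
  rw [ancestorWeight, ancestorWeight, concat_congr q h]

end Weights

/-! ### Laws of the new particle paths -/

section NewPath

variable (M)

/-- The law of the path of an ordinary particle at time `1`. -/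
noncomputable def initPath : Measure (Traj X 1) :=
  ((μ 0).withDensity fun y => M.r 0 Fin.elim0 y).map fun y _ => y

theorem isProbabilityMeasure_initPath (hT : 0 < T) : IsProbabilityMeasure M.initPath := by
  have : IsProbabilityMeasure ((μ 0).withDensity fun y => (M.r 0 Fin.elim0 y : ℝ≥0∞)) :=
    ⟨by simpa using M.lintegral_r 0 hT Fin.elim0⟩
  exact Measure.isProbabilityMeasure_map (by fun_prop)

theorem lintegral_initPath (hT : 0 < T) {f : Traj X 1 → ℝ≥0∞} (hf : Measurable f) :
    ∫⁻ q, f q ∂M.initPath = ∫⁻ y, M.r 0 Fin.elim0 y * f (fun _ => y) ∂μ 0 := by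
  have hr : Measurable fun y => (M.r 0 Fin.elim0 y : ℝ≥0∞) :=
    ((M.measurable_r 0 hT).comp measurable_prodMk_left).coe_nnreal_ennreal
  have hg : Measurable fun y => f (fun _ => y) := hf.comp (by fun_prop)
  rw [initPath, lintegral_map hf (by fun_prop), lintegral_withDensity_eq_lintegral_mul _ hr hg]
  rfl

variable (N : ℕ)

/-- Measurability of appending the new coordinate to the selected ancestor path; here `q` consists
of the reference, the particle paths, the ancestor index and the new coordinate. -/
theorem measurable_extend (t : ℕ) :
    Measurable fun q : (Traj X T × (Fin N → Traj X t)) × (Fin N × X) =>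
      (Fin.snoc (q.1.2 q.2.1) q.2.2 : Traj X (t + 1)) := by
  refine measurable_snoc.comp (Measurable.prodMk ?_ (by fun_prop))
  exact (measurable_from_prod_countable_left
    (f := fun q : (Fin N → Traj X t) × Fin N => q.1 q.2) fun i => measurable_pi_apply i).comp
      ((measurable_snd.comp measurable_fst).prodMk (measurable_fst.comp measurable_snd))

theorem measurable_proposal_density (t : ℕ) (ht : t < T) :
    Measurable fun z : (Traj X T × (Fin N → Traj X t)) × (Fin N × X) =>
      (M.r t (z.1.2 z.2.1) z.2.2 : ℝ≥0∞) := by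
  refine ((M.measurable_r t ht).comp (Measurable.prodMk ?_ (by fun_prop))).coe_nnreal_ennreal
  exact (measurable_from_prod_countable_left
    (f := fun q : (Fin N → Traj X t) × Fin N => q.1 q.2) fun i => measurable_pi_apply i).comp
      ((measurable_snd.comp measurable_fst).prodMk (measurable_fst.comp measurable_snd))

variable [NeZero N]

theorem initStep_apply (hT : 0 < T) (x' : Traj X T) :
    M.initStep N hT x' = Measure.pi (Function.update (fun _ => M.initPath) (refIndex N)
      (Measure.dirac fun _ => x' ⟨0, hT⟩)) := by
  have hI := M.isMarkovKernel_initDraw hT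
  have hκ : ∀ i, IsMarkovKernel (if i = refIndex N then
      Kernel.deterministic (fun x' : Traj X T => x' ⟨0, hT⟩) (measurable_pi_apply _)
      else M.initDraw) := fun i => by split_ifs <;> infer_instance
  have hm : Measurable fun (y : X) (_ : Fin 1) => y := by fun_prop
  unfold initStep
  rw [Kernel.map_apply _ (by fun_prop)]
  change (Measure.pi fun i => (if i = refIndex N then
      Kernel.deterministic (fun x' : Traj X T => x' ⟨0, hT⟩) (measurable_pi_apply _)
      else M.initDraw) x').map (fun (q : Fin N → X) i (_ : Fin 1) => q i) = _
  have (i : Fin N) : IsProbabilityMeasure (((if i = refIndex N then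
      Kernel.deterministic (fun x' : Traj X T => x' ⟨0, hT⟩) (measurable_pi_apply _)
      else M.initDraw) x').map fun (y : X) (_ : Fin 1) => y) :=
    Measure.isProbabilityMeasure_map hm.aemeasurable
  rw [Measure.pi_map_pi fun i => hm.aemeasurable]
  congr 1
  funext i
  by_cases hi : i = refIndex N
  · subst hi; simp [Kernel.deterministic_apply, Measure.map_dirac' hm]
  · simp [hi, initDraw, initPath]

variable (t : ℕ)

/-- The law of the new path `(x_{1:t}^a, x'_{t+1})` of the particle that carries the reference. -/
noncomputable def referencePath (h1 : 1 ≤ t) (ht : t < T) :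
    Kernel (Traj X T × (Fin N → Traj X t)) (Traj X (t + 1)) :=
  (Kernel.id ×ₖ M.referenceDraw N t h1 ht).map fun q => Fin.snoc (q.1.2 q.2.1) q.2.2

instance (h1 : 1 ≤ t) (ht : t < T) : IsMarkovKernel (M.referencePath N t h1 ht) :=
  Kernel.IsMarkovKernel.map _ (measurable_extend N t)

theorem referencePath_apply (h1 : 1 ≤ t) (ht : t < T) (z : Traj X T × (Fin N → Traj X t)) :
    M.referencePath N t h1 ht z =
      (M.referenceDraw N t h1 ht z).map
        fun ay => (Fin.snoc (z.2 ay.1) ay.2 : Traj X (t + 1)) := by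
  rw [referencePath, Kernel.map_apply _ (measurable_extend N t), Kernel.prod_apply,
    Kernel.id_apply, Measure.dirac_prod,
    Measure.map_map (measurable_extend N t) measurable_prodMk_left]
  rfl

theorem lintegral_referencePath (h1 : 1 ≤ t) (ht : t < T) (z : Traj X T × (Fin N → Traj X t))
    {f : Traj X (t + 1) → ℝ≥0∞} (hf : Measurable f) :
    ∫⁻ q, f q ∂M.referencePath N t h1 ht z =
      ∫⁻ a, f (Fin.snoc (z.2 a) (z.1 ⟨t, ht⟩))
        ∂categorical N (fun l => M.ancestorWeight t z.1 (z.2 l)) := by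
  have hm : Measurable fun ay : Fin N × X => (Fin.snoc (z.2 ay.1) ay.2 : Traj X (t + 1)) :=
    (measurable_extend N t).comp measurable_prodMk_left
  have hg : Measurable fun ay : Fin N × X => f (Fin.snoc (z.2 ay.1) ay.2) := hf.comp hm
  rw [referencePath_apply, lintegral_map hf hm, referenceDraw,
    Kernel.lintegral_prod _ _ _ hg]
  simp only [Kernel.deterministic_apply, Kernel.comap_apply]
  refine lintegral_congr fun a => ?_
  exact lintegral_dirac' _ (hg.comp measurable_prodMk_left)

/-- The total ancestor weight cancels the normalization of the ancestor sampling probabilities. -/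
theorem sum_ancestorWeight_mul_lintegral_referencePath (h1 : 1 ≤ t) (ht : t < T)
    (u : Traj X T) (p : Fin N → Traj X t) {f : Traj X (t + 1) → ℝ≥0∞} (hf : Measurable f) :
    (∑ l, (M.ancestorWeight t u (p l) : ℝ≥0∞)) * ∫⁻ q, f q ∂M.referencePath N t h1 ht (u, p) =
      ∑ a, (M.ancestorWeight t u (p a) : ℝ≥0∞) * f (Fin.snoc (p a) (u ⟨t, ht⟩)) := by
  rw [M.lintegral_referencePath N t h1 ht _ hf, sum_mul_lintegral_categorical]

/-- The law of the new reference path depends only on the part of the reference that is still to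
come, and not on the order of the particles. -/
theorem referencePath_congr (h1 : 1 ≤ t) (ht : t < T) {x x' : Traj X T}
    (h : ∀ s : Fin T, t ≤ s → x s = x' s) (p : Fin N → Traj X t) (σ : Equiv.Perm (Fin N)) :
    M.referencePath N t h1 ht (x, p ∘ σ) = M.referencePath N t h1 ht (x', p) := by
  refine Measure.ext_of_lintegral _ fun f hf => ?_
  rw [lintegral_referencePath _ _ _ _ _ _ hf, lintegral_referencePath _ _ _ _ _ _ hf]
  simp only [ancestorWeight_congr h, h ⟨t, ht⟩ le_rfl]
  exact lintegral_categorical_perm (fun l => M.ancestorWeight t x' (p l))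
    (fun a => f (Fin.snoc (p a) (x' ⟨t, ht⟩))) σ

variable [∀ t, SigmaFinite (μ t)]

theorem lintegral_proposalDraw (ht : t < T) (z : Traj X T × (Fin N → Traj X t))
    {f : Fin N × X → ℝ≥0∞} (hf : Measurable f) :
    ∫⁻ ay, f ay ∂M.proposalDraw N t ht.le z =
      ∫⁻ a, ∫⁻ y, M.r t (z.2 a) y * f (a, y) ∂μ t
        ∂categorical N (fun l => M.weight t (z.2 l)) := by
  have hm := M.measurable_proposal_density N t ht
  have hmz : Measurable fun ay : Fin N × X => (M.r t (z.2 ay.1) ay.2 : ℝ≥0∞) :=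
    hm.comp (measurable_const.prodMk measurable_id)
  unfold proposalDraw
  rw [Kernel.lintegral_withDensity _ hm _ hf, Kernel.prod_apply, Kernel.const_apply,
    Kernel.comap_apply, lintegral_prod (fun ay : Fin N × X => M.r t (z.2 ay.1) ay.2 * f ay)
      (hmz.mul hf).aemeasurable]

/-- The law of the new path `(x_{1:t}^a, x_{t+1})` of an ordinary particle. -/
noncomputable def proposalPath (ht : t ≤ T) :
    Kernel (Traj X T × (Fin N → Traj X t)) (Traj X (t + 1)) :=
  (Kernel.id ×ₖ M.proposalDraw N t ht).map fun q => Fin.snoc (q.1.2 q.2.1) q.2.2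

theorem isMarkovKernel_proposalPath (ht : t < T) : IsMarkovKernel (M.proposalPath N t ht.le) := by
  have := M.isMarkovKernel_proposalDraw N t ht
  exact Kernel.IsMarkovKernel.map _ (measurable_extend N t)

theorem proposalPath_apply (ht : t < T) (z : Traj X T × (Fin N → Traj X t)) :
    M.proposalPath N t ht.le z =
      (M.proposalDraw N t ht.le z).map fun ay => (Fin.snoc (z.2 ay.1) ay.2 : Traj X (t + 1)) := by
  have := M.isMarkovKernel_proposalDraw N t ht
  rw [proposalPath, Kernel.map_apply _ (measurable_extend N t), Kernel.prod_apply,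
    Kernel.id_apply, Measure.dirac_prod,
    Measure.map_map (measurable_extend N t) measurable_prodMk_left]
  rfl

theorem lintegral_proposalPath (ht : t < T) (z : Traj X T × (Fin N → Traj X t))
    {f : Traj X (t + 1) → ℝ≥0∞} (hf : Measurable f) :
    ∫⁻ q, f q ∂M.proposalPath N t ht.le z =
      ∫⁻ a, ∫⁻ y, M.r t (z.2 a) y * f (Fin.snoc (z.2 a) y) ∂μ t
        ∂categorical N (fun l => M.weight t (z.2 l)) := by
  have hm : Measurable fun ay : Fin N × X => (Fin.snoc (z.2 ay.1) ay.2 : Traj X (t + 1)) :=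
    (measurable_extend N t).comp measurable_prodMk_left
  have hg : Measurable fun ay : Fin N × X => f (Fin.snoc (z.2 ay.1) ay.2) := hf.comp hm
  rw [M.proposalPath_apply N t ht, lintegral_map hf hm, M.lintegral_proposalDraw N t ht _ hg]

/-- The law of an ordinary new path does not depend on the reference or on the order of the
particles. -/
theorem proposalPath_congr (ht : t < T) (x x' : Traj X T) (p : Fin N → Traj X t)
    (σ : Equiv.Perm (Fin N)) :
    M.proposalPath N t ht.le (x, p ∘ σ) = M.proposalPath N t ht.le (x', p) := by
  refine Measure.ext_of_lintegral _ fun f hf => ?_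
  rw [M.lintegral_proposalPath N t ht _ hf, M.lintegral_proposalPath N t ht _ hf]
  exact lintegral_categorical_perm (fun l => M.weight t (p l))
    (fun a => ∫⁻ y, M.r t (p a) y * f (Fin.snoc (p a) y) ∂μ t) σ

/-- Given the current particles, the new paths are independent: the marked one follows the reference
law and all others the proposal law. -/
theorem step_apply (h1 : 1 ≤ t) (ht : t < T) (z : Traj X T × (Fin N → Traj X t)) :
    M.step N t h1 ht z = Measure.pi (Function.update (fun _ => M.proposalPath N t ht.le z)
      (refIndex N) (M.referencePath N t h1 ht z)) := by
  have hP := M.isMarkovKernel_proposalDraw N t ht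
  have hκ : ∀ i, IsMarkovKernel (if i = refIndex N then M.referenceDraw N t h1 ht
      else M.proposalDraw N t ht.le) := fun i => by split_ifs <;> infer_instance
  have hm : Measurable fun ay : Fin N × X => (Fin.snoc (z.2 ay.1) ay.2 : Traj X (t + 1)) :=
    (measurable_extend N t).comp measurable_prodMk_left
  have hmap : Measurable fun q : (Traj X T × (Fin N → Traj X t)) × (Fin N → Fin N × X) =>
      fun i => (Fin.snoc (q.1.2 (q.2 i).1) (q.2 i).2 : Traj X (t + 1)) :=
    measurable_pi_lambda _ fun i => (measurable_extend N t).comp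
      (measurable_fst.prodMk ((measurable_pi_apply i).comp measurable_snd))
  unfold step
  rw [Kernel.map_apply _ hmap, Kernel.prod_apply, Kernel.id_apply, Measure.dirac_prod,
    Measure.map_map hmap measurable_prodMk_left]
  change (Measure.pi fun i => (if i = refIndex N then M.referenceDraw N t h1 ht
      else M.proposalDraw N t ht.le) z).map
    (fun (q : Fin N → Fin N × X) i => (Fin.snoc (z.2 (q i).1) (q i).2 : Traj X (t + 1))) = _
  have (i : Fin N) : IsProbabilityMeasure (((if i = refIndex N then M.referenceDraw N t h1 ht
      else M.proposalDraw N t ht.le) z).map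
        fun ay => (Fin.snoc (z.2 ay.1) ay.2 : Traj X (t + 1))) :=
    Measure.isProbabilityMeasure_map hm.aemeasurable
  rw [Measure.pi_map_pi fun i => hm.aemeasurable]
  congr 1
  funext i
  by_cases hi : i = refIndex N
  · subst hi; simp [referencePath_apply]
  · simp [hi, proposalPath_apply M N t ht]

instance (h1 : 1 ≤ t) (ht : t < T) : IsMarkovKernel (M.step N t h1 ht) := by
  refine ⟨fun z => ?_⟩
  have := M.isMarkovKernel_proposalPath N t ht
  have (i : Fin N) : IsProbabilityMeasure (Function.update (fun _ : Fin N =>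
      M.proposalPath N t ht.le z) (refIndex N) (M.referencePath N t h1 ht z) i) := by
    by_cases hi : i = refIndex N
    · subst hi; rw [Function.update_self]; infer_instance
    · rw [Function.update_of_ne hi]; infer_instance
  rw [step_apply]
  infer_instance

theorem step_congr (h1 : 1 ≤ t) (ht : t < T) {x x' : Traj X T}
    (h : ∀ s : Fin T, t ≤ s → x s = x' s) (p : Fin N → Traj X t) (σ : Equiv.Perm (Fin N)) :
    M.step N t h1 ht (x, p ∘ σ) = M.step N t h1 ht (x', p) := by
  rw [step_apply, step_apply, M.proposalPath_congr N t ht x x' p σ,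
    M.referencePath_congr N t h1 ht h p σ]

end NewPath

/-! ### Plain sequential Monte Carlo -/

section Smc

variable (M) [∀ t, SigmaFinite (μ t)] (N : ℕ) [NeZero N]
variable (x₀ : Traj X T)

/-- One step of plain sequential Monte Carlo: `N` independent new paths, all drawn from the
proposal. The proposal ignores the reference, which is set to an arbitrary point `x₀`. -/
noncomputable def smcStep (t : ℕ) (ht : t < T) :
    Kernel (Fin N → Traj X t) (Fin N → Traj X (t + 1)) :=
  haveI := M.isMarkovKernel_proposalPath N t ht
  indep fun _ : Fin N => (M.proposalPath N t ht.le).comap (fun p => (x₀, p)) measurable_prodMk_left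

instance (t : ℕ) (ht : t < T) : IsMarkovKernel (M.smcStep N x₀ t ht) := by
  unfold smcStep
  infer_instance

/-- The unnormalized law of the particle paths at time `t + 1` under plain sequential Monte Carlo:
the law of `N` exchangeable particles, reweighted by the product over the earlier time steps of
the average particle weight. The index is shifted by one because there is always a first draw, and
the base point `x₀` has no influence. -/
noncomputable def smcMeasure : (t : ℕ) → t < T → Measure (Fin N → Traj X (t + 1))
  | 0, _ => Measure.pi fun _ => M.initPath
  | t + 1, h => ((smcMeasure t (Nat.lt_of_succ_lt h)).withDensity
      fun p => (N : ℝ≥0∞)⁻¹ * ∑ l, (M.weight (t + 1) (p l) : ℝ≥0∞)).bind (M.smcStep N x₀ (t + 1) h)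

theorem smcStep_apply (t : ℕ) (ht : t < T) (p : Fin N → Traj X t) :
    M.smcStep N x₀ t ht p = Measure.pi fun _ => M.proposalPath N t ht.le (x₀, p) := rfl

theorem sFinite_smcMeasure : ∀ (t : ℕ) (ht : t < T), SFinite (M.smcMeasure N x₀ t ht)
  | 0, h => by
    have := M.isProbabilityMeasure_initPath h
    unfold smcMeasure
    infer_instance
  | t + 1, h => by
    have := sFinite_smcMeasure t (Nat.lt_of_succ_lt h)
    unfold smcMeasure
    infer_instance

theorem lintegral_smcMeasure_succ (t : ℕ) (h : t + 1 < T)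
    {f : (Fin N → Traj X (t + 2)) → ℝ≥0∞} (hf : Measurable f) :
    ∫⁻ p, f p ∂M.smcMeasure N x₀ (t + 1) h =
      ∫⁻ p, (N : ℝ≥0∞)⁻¹ * ((∑ l, (M.weight (t + 1) (p l) : ℝ≥0∞)) *
        ∫⁻ p', f p' ∂M.smcStep N x₀ (t + 1) h p)
          ∂M.smcMeasure N x₀ t (Nat.lt_of_succ_lt h) := by
  have hw := M.measurable_weight (t + 1) h.le
  rw [smcMeasure, Measure.lintegral_bind (Kernel.aemeasurable _) hf.aemeasurable,
    lintegral_withDensity_eq_lintegral_mul _ (by fun_prop) (by fun_prop)]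
  simp only [Pi.mul_apply, mul_assoc]

/-- Exchangeability: given the past, the paths are independent and identically distributed. -/
theorem lintegral_smcMeasure_perm (t : ℕ) (ht : t < T) (σ : Equiv.Perm (Fin N))
    {f : (Fin N → Traj X (t + 1)) → ℝ≥0∞} (hf : Measurable f) :
    ∫⁻ p, f (p ∘ σ) ∂M.smcMeasure N x₀ t ht = ∫⁻ p, f p ∂M.smcMeasure N x₀ t ht := by
  have hσ : Measurable fun p : Fin N → Traj X (t + 1) => p ∘ σ := by fun_prop
  cases t with
  | zero =>
    have := M.isProbabilityMeasure_initPath ht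
    rw [smcMeasure, ← lintegral_map hf hσ, pi_map_perm]
  | succ t =>
    have := M.isMarkovKernel_proposalPath N (t + 1) ht
    rw [M.lintegral_smcMeasure_succ N x₀ t ht (f := fun p => f (p ∘ σ)) (hf.comp hσ),
      M.lintegral_smcMeasure_succ N x₀ t ht hf]
    refine lintegral_congr fun p => ?_
    rw [smcStep_apply, ← lintegral_map hf hσ, pi_map_perm]

/-- Averaging over the particles: by exchangeability the marked particle may be any of them, as long
as the remaining factor is symmetric. -/
theorem lintegral_smcMeasure_symmetrize (t : ℕ) (ht : t < T) (i : Fin N)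
    {g : Traj X (t + 1) → ℝ≥0∞} (hg : Measurable g)
    {f : (Fin N → Traj X (t + 1)) → ℝ≥0∞} (hf : Measurable f)
    (hsymm : ∀ (σ : Equiv.Perm (Fin N)) p, f (p ∘ σ) = f p) :
    ∫⁻ p, g (p i) * f p ∂M.smcMeasure N x₀ t ht =
      ∫⁻ p, (N : ℝ≥0∞)⁻¹ * ((∑ l, g (p l)) * f p) ∂M.smcMeasure N x₀ t ht := by
  have hm (l : Fin N) : Measurable fun p : Fin N → Traj X (t + 1) => g (p l) * f p :=
    (hg.comp (measurable_pi_apply l)).mul hf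
  have hl (l : Fin N) : ∫⁻ p, g (p l) * f p ∂M.smcMeasure N x₀ t ht =
      ∫⁻ p, g (p i) * f p ∂M.smcMeasure N x₀ t ht := by
    rw [← M.lintegral_smcMeasure_perm N x₀ t ht (Equiv.swap l i) (hm l)]
    simp [hsymm]
  simp only [Finset.sum_mul]
  rw [lintegral_const_mul _ (Finset.measurable_sum _ fun l _ => hm l),
    lintegral_finsetSum _ fun l _ => hm l]
  simp only [hl, Finset.sum_const, Finset.card_univ, Fintype.card_fin, nsmul_eq_mul]
  rw [← mul_assoc, ENNReal.inv_mul_cancel (by simpa using NeZero.ne N) (ENNReal.natCast_ne_top N),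
    one_mul]

/-- The total weight cancels the normalization of the ancestor probabilities. -/
theorem sum_weight_mul_lintegral_proposalPath (t : ℕ) (ht : t < T) (p : Fin N → Traj X t)
    {f : Traj X (t + 1) → ℝ≥0∞} (hf : Measurable f) :
    (∑ l, (M.weight t (p l) : ℝ≥0∞)) * ∫⁻ q, f q ∂M.proposalPath N t ht.le (x₀, p) =
      ∑ a, (M.weight t (p a) : ℝ≥0∞) * ∫⁻ y, M.r t (p a) y * f (Fin.snoc (p a) y) ∂μ t := by
  rw [M.lintegral_proposalPath N t ht _ hf, sum_mul_lintegral_categorical]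

variable {M}

/-- Sequential Monte Carlo is unbiased: a weighted particle path integrates test functions to
their integral against the unnormalized target. -/
theorem SupportCondition.lintegral_weight_smcMeasure (hM : M.SupportCondition) (t : ℕ)
    (ht : t < T) (i : Fin N) {f : Traj X (t + 1) → ℝ≥0∞} (hf : Measurable f) :
    ∫⁻ p, M.weight (t + 1) (p i) * f (p i) ∂M.smcMeasure N x₀ t ht =
      ∫⁻ x, M.γ (t + 1) x * f x ∂trajMeasure μ (t + 1) := by
  have hw := M.measurable_weight (t + 1) ht
  have hγ := M.measurable_γ (t + 1) (Nat.le_add_left 1 t) ht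
  induction t generalizing i with
  | zero =>
    have := M.isProbabilityMeasure_initPath ht
    rw [smcMeasure, lintegral_pi_eval M.initPath i (f := fun q => (M.weight 1 q : ℝ≥0∞) * f q)
      (by fun_prop), M.lintegral_initPath ht (by fun_prop),
      lintegral_trajMeasure_one μ (by fun_prop)]
    refine lintegral_congr fun y => ?_
    rw [← mul_assoc, ← ENNReal.coe_mul, hM.proposal_mul_weight_one ht]
  | succ t ih =>
    have := M.isMarkovKernel_proposalPath N (t + 1) ht
    have hwt := M.measurable_weight (t + 1) ht.le
    have hr := M.measurable_r (t + 1) ht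
    have hγt := M.measurable_γ (t + 1) (Nat.le_add_left 1 t) ht.le
    -- the mean of `f` over the offspring of the path `q`, with the new weight
    set g : Traj X (t + 1) → ℝ≥0∞ := fun q => ∫⁻ y, (M.r (t + 1) q y : ℝ≥0∞) *
      (M.weight (t + 2) (Fin.snoc q y) * f (Fin.snoc q y)) ∂μ (t + 1) with hg
    have hgm : Measurable g := by
      refine Measurable.lintegral_prod_right' (f := fun z : Traj X (t + 1) × X =>
        (M.r (t + 1) z.1 z.2 : ℝ≥0∞) *
          ((M.weight (t + 2) (Fin.snoc z.1 z.2 : Traj X (t + 2)) : ℝ≥0∞) *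
            f (Fin.snoc z.1 z.2))) ?_
      exact hr.coe_nnreal_ennreal.mul ((hw.coe_nnreal_ennreal.mul hf).comp measurable_snoc)
    have hgp (l : Fin N) : Measurable fun p : Fin N → Traj X (t + 1) =>
        (M.weight (t + 1) (p l) : ℝ≥0∞) * g (p l) := by fun_prop
    rw [M.lintegral_smcMeasure_succ N x₀ t ht (by fun_prop)]
    have hstep (p : Fin N → Traj X (t + 1)) :
        (∑ l, (M.weight (t + 1) (p l) : ℝ≥0∞)) *
          ∫⁻ p', M.weight (t + 2) (p' i) * f (p' i) ∂M.smcStep N x₀ (t + 1) ht p =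
        ∑ a, (M.weight (t + 1) (p a) : ℝ≥0∞) * g (p a) := by
      rw [smcStep_apply, lintegral_pi_eval _ i (f := fun q => (M.weight (t + 2) q : ℝ≥0∞) * f q)
        (by fun_prop), M.sum_weight_mul_lintegral_proposalPath N x₀ (t + 1) ht p (by fun_prop)]
    simp only [hstep]
    rw [lintegral_const_mul _ (Finset.measurable_sum _ fun l _ => hgp l),
      lintegral_finsetSum _ fun l _ => hgp l]
    have hl (l : Fin N) : ∫⁻ p, M.weight (t + 1) (p l) * g (p l)
        ∂M.smcMeasure N x₀ t (Nat.lt_of_succ_lt ht) =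
        ∫⁻ q, M.γ (t + 1) q * g q ∂trajMeasure μ (t + 1) := by
      exact ih (Nat.lt_of_succ_lt ht) l hgm hwt hγt
    simp only [hl, Finset.sum_const, Finset.card_univ, Fintype.card_fin, nsmul_eq_mul]
    rw [← mul_assoc, ENNReal.inv_mul_cancel (by simpa using NeZero.ne N)
      (ENNReal.natCast_ne_top N), one_mul,
      lintegral_trajMeasure_succ (t := t + 1) μ
        (f := fun x => (M.γ (t + 2) x : ℝ≥0∞) * f x) (hγ.coe_nnreal_ennreal.mul hf)]
    refine lintegral_congr fun q => ?_
    have hq : Measurable fun y => (M.r (t + 1) q y : ℝ≥0∞) *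
        (M.weight (t + 2) (Fin.snoc q y) * f (Fin.snoc q y)) :=
      (hr.coe_nnreal_ennreal.mul ((hw.coe_nnreal_ennreal.mul hf).comp measurable_snoc)).comp
        measurable_prodMk_left
    rw [hg, ← lintegral_const_mul _ hq]
    refine lintegral_congr fun y => ?_
    rw [← hM.gamma_mul_weight (Nat.le_add_left 1 t) ht]
    push_cast
    ring

end Smc

variable (N : ℕ) [NeZero N]

/-! ### Markov property -/

section Markov

variable (M)

theorem isMarkovKernel_initStep (hT : 0 < T) : IsMarkovKernel (M.initStep N hT) := by
  have := M.isMarkovKernel_initDraw hT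
  have (i : Fin N) : IsMarkovKernel (if i = refIndex N then
      Kernel.deterministic (fun x' : Traj X T => x' ⟨0, hT⟩) (measurable_pi_apply _)
      else M.initDraw) := by split_ifs <;> infer_instance
  unfold initStep
  exact Kernel.IsMarkovKernel.map _ (by fun_prop)

variable [∀ t, SigmaFinite (μ t)]

theorem isMarkovKernel_paths : ∀ (t : ℕ) (ht : t ≤ T), IsMarkovKernel (M.paths N t ht)
  | 0, _ => by unfold paths; infer_instance
  | 1, h => M.isMarkovKernel_initStep N h
  | t + 2, h => by
    have := isMarkovKernel_paths (t + 1) (Nat.le_of_succ_le h)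
    unfold paths
    infer_instance

end Markov

/-! ### The final draw -/

section Select

variable (M)

instance : IsMarkovKernel (M.select N) :=
  Kernel.IsMarkovKernel.map _ (measurable_select N T)

theorem lintegral_select (p : Fin N → Traj X T) {f : Traj X T → ℝ≥0∞} (hf : Measurable f) :
    ∫⁻ x, f x ∂M.select N p =
      ∫⁻ k, f (p k) ∂categorical N fun l => M.weight T (p l) := by
  have hg : Measurable fun kp : Fin N × (Fin N → Traj X T) => f (kp.2 kp.1) :=
    hf.comp (measurable_select N T)
  unfold select
  rw [Kernel.lintegral_map _ (measurable_select N T) _ hf, Kernel.lintegral_prod_id hg]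
  rfl

theorem lintegral_select_perm (σ : Equiv.Perm (Fin N)) (p : Fin N → Traj X T)
    {f : Traj X T → ℝ≥0∞} (hf : Measurable f) :
    ∫⁻ x, f x ∂M.select N (p ∘ σ) = ∫⁻ x, f x ∂M.select N p := by
  rw [M.lintegral_select N _ hf, M.lintegral_select N _ hf]
  exact lintegral_categorical_perm (fun l => M.weight T (p l)) (fun k => f (p k)) σ

end Select

/-! ### The particle system seen from a reference drawn from the target -/

section Invariant

variable [∀ t, SigmaFinite (μ t)] (x₀ : Traj X T)

/-- At time `1`, a reference coordinate integrated out against the target is a proposal draw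
carrying the ancestor weight. -/
theorem SupportCondition.lintegral_initStep (hM : M.SupportCondition) (hT : 0 < T) (u : Traj X T)
    {f : (Fin N → Traj X 1) → ℝ≥0∞} (hf : Measurable f) :
    ∫⁻ y, M.γ T (Function.update u ⟨0, hT⟩ y) *
        ∫⁻ p, f p ∂M.initStep N hT (Function.update u ⟨0, hT⟩ y) ∂μ 0 =
      ∫⁻ p, M.ancestorWeight 1 u (p (refIndex N)) * f p ∂M.smcMeasure N x₀ 0 hT := by
  have := M.isProbabilityMeasure_initPath hT
  have ha : Measurable fun q => (M.ancestorWeight 1 u q : ℝ≥0∞) :=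
    ((M.measurable_ancestorWeight 1 le_rfl hT).comp measurable_prodMk_left).coe_nnreal_ennreal
  have hH : Measurable fun q => ∫⁻ p, f (Function.update p (refIndex N) q)
      ∂(Measure.pi fun _ : Fin N => M.initPath) :=
    Measurable.lintegral_prod_right' (hf.comp (measurable_update_prod (refIndex N)))
  rw [smcMeasure, lintegral_pi_eval_mul _ _ ha hf,
    M.lintegral_initPath hT (f := fun q => M.ancestorWeight 1 u q *
      ∫⁻ p, f (Function.update p (refIndex N) q) ∂(Measure.pi fun _ : Fin N => M.initPath))
      (ha.mul hH)]
  refine lintegral_congr fun y => ?_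
  rw [initStep_apply, lintegral_pi_update _ _ _ hf, lintegral_dirac' _ hH, Function.update_self,
    ← mul_assoc, ← ENNReal.coe_mul, hM.proposal_mul_ancestorWeight_one hT]

/-- At later times, a reference coordinate integrated out against the law of the particles with
marked ancestor weight turns one step of the conditional algorithm into one step of plain sequential
Monte Carlo. -/
theorem SupportCondition.lintegral_step (hM : M.SupportCondition) (t : ℕ) (ht : t + 1 < T)
    (u : Traj X T) {f : (Fin N → Traj X (t + 2)) → ℝ≥0∞} (hf : Measurable f) :
    ∫⁻ y, ∫⁻ p, M.ancestorWeight (t + 1) (Function.update u ⟨t + 1, ht⟩ y) (p (refIndex N)) *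
        ∫⁻ p', f p' ∂M.step N (t + 1) (Nat.le_add_left 1 t) ht
          (Function.update u ⟨t + 1, ht⟩ y, p)
        ∂M.smcMeasure N x₀ t (Nat.lt_of_succ_lt ht) ∂μ (t + 1) =
      ∫⁻ p, M.ancestorWeight (t + 2) u (p (refIndex N)) * f p
        ∂M.smcMeasure N x₀ (t + 1) ht := by
  have := M.isMarkovKernel_proposalPath N (t + 1) ht
  have := M.sFinite_smcMeasure N x₀ t (Nat.lt_of_succ_lt ht)
  have h1 : 1 ≤ t + 1 := Nat.le_add_left 1 t
  have hupd : Measurable fun y : X => Function.update u ⟨t + 1, ht⟩ y := measurable_update u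
  have ha (v : Traj X T) : Measurable fun q => (M.ancestorWeight (t + 1) v q : ℝ≥0∞) :=
    ((M.measurable_ancestorWeight (t + 1) h1 ht.le).comp
      measurable_prodMk_left).coe_nnreal_ennreal
  have ha' : Measurable fun q => (M.ancestorWeight (t + 2) u q : ℝ≥0∞) :=
    ((M.measurable_ancestorWeight (t + 2) (Nat.le_add_left 1 _) ht).comp
      measurable_prodMk_left).coe_nnreal_ennreal
  have hay (a : Fin N) : Measurable fun z : X × (Fin N → Traj X (t + 1)) =>
      (M.ancestorWeight (t + 1) (Function.update u ⟨t + 1, ht⟩ z.1) (z.2 a) : ℝ≥0∞) :=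
    ((M.measurable_ancestorWeight (t + 1) h1 ht.le).comp
      ((hupd.comp measurable_fst).prodMk
        ((measurable_pi_apply a).comp measurable_snd))).coe_nnreal_ennreal
  -- the mean of `f` when the marked particle has path `q` and the others are drawn as usual
  set H : (Fin N → Traj X (t + 1)) → Traj X (t + 2) → ℝ≥0∞ := fun p q =>
    ∫⁻ p', f (Function.update p' (refIndex N) q) ∂M.smcStep N x₀ (t + 1) ht p
  have hHm : Measurable fun z : (Fin N → Traj X (t + 1)) × Traj X (t + 2) => H z.1 z.2 := by
    refine Measurable.lintegral_kernel_prod_right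
      (κ := (M.smcStep N x₀ (t + 1) ht).comap Prod.fst measurable_fst)
      (f := fun z p' => f (Function.update p' (refIndex N) z.2)) ?_
    exact hf.comp ((measurable_update_prod (refIndex N)).comp
      ((measurable_snd.comp measurable_fst).prodMk measurable_snd))
  have hHp (p : Fin N → Traj X (t + 1)) : Measurable (H p) := hHm.comp measurable_prodMk_left
  have hstep (v : Traj X T) (p : Fin N → Traj X (t + 1)) :
      ∫⁻ p', f p' ∂M.step N (t + 1) h1 ht (v, p) =
        ∫⁻ q, H p q ∂M.referencePath N (t + 1) h1 ht (v, p) := by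
    have hv : M.proposalPath N (t + 1) ht.le (v, p) = M.proposalPath N (t + 1) ht.le (x₀, p) :=
      M.proposalPath_congr N (t + 1) ht v x₀ p (Equiv.refl _)
    rw [step_apply, lintegral_pi_update _ _ _ hf, hv]
    rfl
  have hleft (y : X) :
      ∫⁻ p, M.ancestorWeight (t + 1) (Function.update u ⟨t + 1, ht⟩ y) (p (refIndex N)) *
        ∫⁻ p', f p' ∂M.step N (t + 1) h1 ht (Function.update u ⟨t + 1, ht⟩ y, p)
        ∂M.smcMeasure N x₀ t (Nat.lt_of_succ_lt ht) =
      ∫⁻ p, (N : ℝ≥0∞)⁻¹ * ∑ a,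
        (M.ancestorWeight (t + 1) (Function.update u ⟨t + 1, ht⟩ y) (p a) : ℝ≥0∞) *
          H p (Fin.snoc (p a) y) ∂M.smcMeasure N x₀ t (Nat.lt_of_succ_lt ht) := by
    rw [M.lintegral_smcMeasure_symmetrize N x₀ t _ (refIndex N) (ha _)
      (f := fun p => ∫⁻ p', f p' ∂M.step N (t + 1) h1 ht (Function.update u ⟨t + 1, ht⟩ y, p))
      (hf.lintegral_kernel.comp measurable_prodMk_left) fun σ p => by
        rw [M.step_congr N (t + 1) h1 ht (fun _ _ => rfl) p σ]]
    refine lintegral_congr fun p => ?_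
    -- the average ancestor weight meets the ancestor sampling probabilities
    rw [hstep, M.sum_ancestorWeight_mul_lintegral_referencePath N (t + 1) h1 ht _ p (hHp p)]
    simp only [Function.update_self]
  have hright (p : Fin N → Traj X (t + 1)) :
      (∑ l, (M.weight (t + 1) (p l) : ℝ≥0∞)) *
        ∫⁻ p', M.ancestorWeight (t + 2) u (p' (refIndex N)) * f p'
          ∂M.smcStep N x₀ (t + 1) ht p =
      ∑ a, ∫⁻ y, (M.ancestorWeight (t + 1) (Function.update u ⟨t + 1, ht⟩ y) (p a) : ℝ≥0∞) *
        H p (Fin.snoc (p a) y) ∂μ (t + 1) := by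
    rw [smcStep_apply, lintegral_pi_eval_mul _ _ ha' hf]
    change (∑ l, (M.weight (t + 1) (p l) : ℝ≥0∞)) *
      ∫⁻ q, M.ancestorWeight (t + 2) u q * H p q ∂M.proposalPath N (t + 1) ht.le (x₀, p) = _
    rw [M.sum_weight_mul_lintegral_proposalPath N x₀ (t + 1) ht p
      (f := fun q => M.ancestorWeight (t + 2) u q * H p q) (ha'.mul (hHp p))]
    refine Finset.sum_congr rfl fun a _ => ?_
    have hr : Measurable fun y => (M.r (t + 1) (p a) y : ℝ≥0∞) :=
      ((M.measurable_r (t + 1) ht).comp measurable_prodMk_left).coe_nnreal_ennreal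
    rw [← lintegral_const_mul _ (f := fun y => M.r (t + 1) (p a) y *
      (M.ancestorWeight (t + 2) u (Fin.snoc (p a) y) * H p (Fin.snoc (p a) y)))
      (hr.mul ((ha'.mul (hHp p)).comp (measurable_snoc.comp measurable_prodMk_left)))]
    refine lintegral_congr fun y => ?_
    rw [← hM.weight_mul_ancestorWeight h1 ht]
    push_cast
    ring
  have hm (a : Fin N) : Measurable fun z : X × (Fin N → Traj X (t + 1)) =>
      (M.ancestorWeight (t + 1) (Function.update u ⟨t + 1, ht⟩ z.1) (z.2 a) : ℝ≥0∞) *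
        H z.2 (Fin.snoc (z.2 a) z.1) :=
    (hay a).mul (hHm.comp (measurable_snd.prodMk (measurable_snoc.comp
      (((measurable_pi_apply a).comp measurable_snd).prodMk measurable_fst))))
  -- both sides are now the same sum over the ancestors `a`, integrated in different orders
  simp only [hleft]
  rw [lintegral_lintegral_swap (f := fun y p => (N : ℝ≥0∞)⁻¹ * ∑ a,
        (M.ancestorWeight (t + 1) (Function.update u ⟨t + 1, ht⟩ y) (p a) : ℝ≥0∞) *
          H p (Fin.snoc (p a) y))
      ((Finset.measurable_sum _ fun a _ => hm a).const_mul _).aemeasurable,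
    M.lintegral_smcMeasure_succ N x₀ t ht
      (f := fun p => M.ancestorWeight (t + 2) u (p (refIndex N)) * f p)
      ((ha'.comp (measurable_pi_apply (refIndex N))).mul hf)]
  refine lintegral_congr fun p => ?_
  have hmp (a : Fin N) : Measurable fun y : X =>
      (M.ancestorWeight (t + 1) (Function.update u ⟨t + 1, ht⟩ y) (p a) : ℝ≥0∞) *
        H p (Fin.snoc (p a) y) :=
    (hm a).comp (measurable_id.prodMk measurable_const)
  rw [hright, lintegral_const_mul _ (Finset.measurable_sum _ fun a _ => hmp a),
    lintegral_finsetSum _ fun a _ => hmp a]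

/-- For a reference drawn from the (unnormalized) target, the particle paths at time `t + 1` and
the remaining reference `x'_{t+2:T}` have joint density
`u ↦ W(x_{1:t+1}^N) γ_T(x_{1:t+1}^N, u) / γ_{t+1}(x_{1:t+1}^N)` with respect to plain sequential
Monte Carlo and the dominating measure of the remaining coordinates. The latter integral is
written as a marginal, over the coordinates after `t`, of a function on the whole of `X ^ T`. -/
theorem SupportCondition.lintegral_paths (hM : M.SupportCondition) (t : ℕ) (ht : t < T)
    {f : Traj X T × (Fin N → Traj X (t + 1)) → ℝ≥0∞} (hf : Measurable f)
    (hdep : ∀ x x' p, (∀ s : Fin T, t + 1 ≤ s → x s = x' s) → f (x, p) = f (x', p)) :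
    ∫⁻ x', M.γ T x' * ∫⁻ p, f (x', p) ∂M.paths N (t + 1) ht x' ∂trajMeasure μ T =
      lmarginal (fun s : Fin T => μ s) (Finset.univ.filter fun s : Fin T => t + 1 ≤ (s : ℕ))
        (fun u => ∫⁻ p, M.ancestorWeight (t + 1) u (p (refIndex N)) * f (u, p)
          ∂M.smcMeasure N x₀ t ht) x₀ := by
  induction t with
  | zero =>
    have := M.isMarkovKernel_initStep N ht
    generalize hS : (Finset.univ.filter fun s : Fin T => 0 + 1 ≤ (s : ℕ)) = S
    have huniv : (Finset.univ : Finset (Fin T)) = insert ⟨0, ht⟩ S := by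
      ext s
      simp [← hS, Fin.ext_iff]
      omega
    have hnot : (⟨0, ht⟩ : Fin T) ∉ S := by simp [← hS]
    have hG : Measurable fun x' => (M.γ T x' : ℝ≥0∞) * ∫⁻ p, f (x', p) ∂M.initStep N ht x' :=
      ((M.measurable_γ T (Nat.one_le_iff_ne_zero.2 ht.ne') le_rfl).coe_nnreal_ennreal).mul
        hf.lintegral_kernel_prod_right'
    rw [trajMeasure, lintegral_eq_lmarginal_univ x₀]
    change lmarginal _ _ (fun x' => (M.γ T x' : ℝ≥0∞) * ∫⁻ p, f (x', p) ∂M.initStep N ht x') _ = _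
    rw [huniv, lmarginal_insert' _ hG hnot]
    congr 1
    funext u
    rw [← hM.lintegral_initStep N x₀ ht u (f := fun p => f (u, p))
      (hf.comp measurable_prodMk_left)]
    refine lintegral_congr fun y => ?_
    congr 1
    refine lintegral_congr fun p => hdep _ _ _ fun s hs => Function.update_of_ne ?_ _ _
    rintro rfl
    simp at hs
  | succ t ih =>
    have h1 : 1 ≤ t + 1 := Nat.le_add_left 1 t
    have hins : (Finset.univ.filter fun s : Fin T => t + 1 ≤ (s : ℕ)) = insert ⟨t + 1, ht⟩
        (Finset.univ.filter fun s : Fin T => t + 1 + 1 ≤ (s : ℕ)) := by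
      ext s
      simp [Fin.ext_iff]
      omega
    -- the conditional mean of `f` one step ahead; it satisfies the hypotheses of the induction
    set g : Traj X T × (Fin N → Traj X (t + 1)) → ℝ≥0∞ := fun z =>
      ∫⁻ p', f (z.1, p') ∂M.step N (t + 1) h1 ht z with hg
    have hgm : Measurable g :=
      Measurable.lintegral_kernel_prod_right
        (f := fun (z : Traj X T × (Fin N → Traj X (t + 1))) p' => f (z.1, p'))
        (hf.comp ((measurable_fst.comp measurable_fst).prodMk measurable_snd))
    have hleft (x' : Traj X T) : ∫⁻ p, f (x', p) ∂M.paths N (t + 2) ht x' =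
        ∫⁻ p, g (x', p) ∂M.paths N (t + 1) (Nat.le_of_succ_le ht) x' := by
      have hfx : Measurable fun p => f (x', p) := hf.comp measurable_prodMk_left
      have := M.isMarkovKernel_paths N (t + 1) (Nat.le_of_succ_le ht)
      change ∫⁻ p, f (x', p) ∂(M.step N (t + 1) h1 ht ∘ₖ
        (Kernel.id ×ₖ M.paths N (t + 1) (Nat.le_of_succ_le ht))) x' = _
      rw [Kernel.lintegral_comp _ _ _ hfx, Kernel.lintegral_id_prod hfx.lintegral_kernel]
    simp only [hleft]
    rw [ih (Nat.lt_of_succ_lt ht) hgm fun x x' p h => ?_, hins, lmarginal_insert' _ ?_ (by simp)]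
    · congr 1
      funext u
      rw [← hM.lintegral_step N x₀ t ht u (f := fun p => f (u, p))
        (hf.comp measurable_prodMk_left)]
      refine lintegral_congr fun y => lintegral_congr fun p => ?_
      congr 1
      refine lintegral_congr fun p' => hdep _ _ _ fun s hs => Function.update_of_ne ?_ _ _
      rintro rfl
      simp at hs
    · have := M.sFinite_smcMeasure N x₀ t (Nat.lt_of_succ_lt ht)
      refine Measurable.lintegral_prod_right' (f := fun z : Traj X T × (Fin N → Traj X (t + 1)) =>
        (M.ancestorWeight (t + 1) z.1 (z.2 (refIndex N)) : ℝ≥0∞) * g z) ?_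
      exact ((M.measurable_ancestorWeight (t + 1) h1 ht.le).comp (measurable_fst.prodMk
        ((measurable_pi_apply (refIndex N)).comp measurable_snd))).coe_nnreal_ennreal.mul hgm
    -- the next step reads the reference only at coordinates that are still to come
    · have hs := M.step_congr N (t + 1) h1 ht h p (Equiv.refl _)
      simp only [hg]
      change ∫⁻ p', f (x, p') ∂M.step N (t + 1) h1 ht (x, p ∘ Equiv.refl _) = _
      rw [hs]
      exact lintegral_congr fun p' => hdep _ _ _ fun s hs => h s (Nat.le_of_succ_le hs)

end Invariant

/-! ### Invariance -/

variable [∀ t, SigmaFinite (μ t)]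

/-- Invariance of the unnormalized target, for test functions. The base point `x₀` is only a witness
that trajectories exist. -/
theorem SupportCondition.lintegral_pgasKernel (hM : M.SupportCondition) (hT : 0 < T)
    (x₀ : Traj X T) {f : Traj X T → ℝ≥0∞} (hf : Measurable f) :
    ∫⁻ x', M.γ T x' * ∫⁻ x, f x ∂M.pgasKernel N x' ∂trajMeasure μ T =
      ∫⁻ x, M.γ T x * f x ∂trajMeasure μ T := by
  obtain ⟨t, rfl⟩ : ∃ t, T = t + 1 := ⟨T - 1, by omega⟩
  have hw := M.measurable_weight (t + 1) le_rfl
  have hg : Measurable fun p => ∫⁻ x, f x ∂M.select N p := hf.lintegral_kernel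
  have hempty : (Finset.univ.filter fun s : Fin (t + 1) => t + 1 ≤ (s : ℕ)) = ∅ := by
    ext s
    simpa using Nat.le_of_lt_succ s.2
  have hcomp (x' : Traj X (t + 1)) : ∫⁻ x, f x ∂M.pgasKernel N x' =
      ∫⁻ p, ∫⁻ x, f x ∂M.select N p ∂M.paths N (t + 1) le_rfl x' :=
    Kernel.lintegral_comp _ _ _ hf
  simp only [hcomp]
  rw [hM.lintegral_paths N x₀ t (Nat.lt_succ_self t)
    (f := fun z => ∫⁻ x, f x ∂M.select N z.2) (hg.comp measurable_snd) (fun _ _ _ _ => rfl),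
    hempty, lmarginal_empty]
  simp only [ancestorWeight_full hT]
  rw [M.lintegral_smcMeasure_symmetrize N x₀ t _ (refIndex N) hw.coe_nnreal_ennreal hg
    fun σ p => M.lintegral_select_perm N σ p hf]
  simp only [M.lintegral_select N _ hf, sum_mul_lintegral_categorical]
  have hm : Measurable fun _ : Fin N → Traj X (t + 1) => (1 : ℝ≥0∞) := measurable_const
  -- symmetrization with constant factor `1` returns from the average over particles to one of them
  rw [← hM.lintegral_weight_smcMeasure N x₀ t (Nat.lt_succ_self t) (refIndex N) hf]
  have := M.lintegral_smcMeasure_symmetrize N x₀ t (Nat.lt_succ_self t) (refIndex N)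
    (g := fun q => (M.weight (t + 1) q : ℝ≥0∞) * f q) (by fun_prop) hm fun _ _ => rfl
  simpa using this.symm

end Model

end PGAS

theorem mainTheorem1 {X Θ : Type*} [MeasurableSpace X] (μ : ℕ → Measure X)
    [∀ t, SigmaFinite (μ t)] (T : ℕ) [NeZero T] (M : Θ → PGAS.Model μ T) (N : ℕ) [NeZero N]
    (θ : Θ) (hθ : (M θ).SupportCondition) :
    IsMarkovKernel ((M θ).pgasKernel N) ∧
      ∀ B : Set (PGAS.Traj X T), MeasurableSet B →
        (M θ).target T B = ∫⁻ x', (M θ).pgasKernel N x' B ∂((M θ).target T) := by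
  have hT : 0 < T := NeZero.pos T
  have hpaths := (M θ).isMarkovKernel_paths N T le_rfl
  refine ⟨by unfold PGAS.Model.pgasKernel; infer_instance, fun B hB => ?_⟩
  have hγ : Measurable fun x => ((M θ).γ T x : ℝ≥0∞) :=
    ((M θ).measurable_γ T hT le_rfl).coe_nnreal_ennreal
  have htarget {g : PGAS.Traj X T → ℝ≥0∞} (hg : Measurable g) : ∫⁻ x, g x ∂(M θ).target T =
      ((M θ).normConst T)⁻¹ * ∫⁻ x, (M θ).γ T x * g x ∂PGAS.trajMeasure μ T := by
    rw [PGAS.Model.target, lintegral_withDensity_eq_lintegral_mul _ (hγ.div_const _) hg,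
      ← lintegral_const_mul _ (f := fun x => ((M θ).γ T x : ℝ≥0∞) * g x) (hγ.mul hg)]
    refine lintegral_congr fun x => ?_
    simp only [Pi.mul_apply, div_eq_mul_inv]
    ring
  -- the space of trajectories is nonempty because the normalizing constant is positive
  obtain ⟨x₀⟩ : Nonempty (PGAS.Traj X T) := by
    by_contra h
    have := not_nonempty_iff.1 h
    simpa using (M θ).normConst_pos T hT le_rfl
  have hind : Measurable (B.indicator 1 : PGAS.Traj X T → ℝ≥0∞) := measurable_one.indicator hB
  have h := hθ.lintegral_pgasKernel N hT x₀ hind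
  simp only [lintegral_indicator_one hB] at h
  rw [htarget (Kernel.measurable_coe _ hB), h, ← htarget hind, lintegral_indicator_one hB]
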